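/- **Setting.** Fix finite numbers $N, M, M'$ and a state space $\Omega=\{\omega_1,\dots,\omega_N\}$, with $\Delta\Omega\subset\mathbb R^N$ the simplex of distributions. An experiment with $M$ realizations is a row stochastic matrix $\mathcal E\in\mathbb R^{N\times M}$ (non-negative entries, every row sums to $1$). Its zonotope is $\operatorname{Zon}\mathcal E=\{\mathcal E v: v\in\mathbb R^M,\ 0\le v\le 1\}$. For a prior $\mu\in\Delta\Omega$, $\langle\mathcal E\mid\mu\rangle$ is the distribution on $\mathbb R^N$ that gives weight $p_m=\sum_n\mu_n\mathcal E_{n,m}$ to the posterior $(\mu_n\mathcal E_{n,m}/p_m)_n$, over all $m$ with $p_m>0$. For finitely supported distributions $F,G$ on $\mathbb R^N$, $F\ge_{\mathrm{lcx}}G$ means $\mathbb E_{x\sim F}[\phi(\beta\cdot x)]\ge\mathbb E_{x\sim G}[\phi(\beta\cdot x)]$ for all convex $\phi:\mathbb R\to\mathbb R$ and all $\beta\in\mathbb R^N$. A moral hazard environment is a triple $P=(\mu_0,u,C)$ where - $\mu_0\in\Delta\Omega$ is the target; - $u:\mathbb R\to\mathbb R$ is a strictly increasing, continuous, concave function, unbounded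 above and below, with $u(0)=0$; - $C:\Delta\Omega\to[0,\infty]$ is lower semicontinuous and convex, vanishes at some point of $\Delta\Omega$, and is Gateaux differentiable: there is $\nabla C:\Delta\Omega\to[-\infty,\infty]^N$ such that for all $\mu,\mu'\in\Delta\Omega$ with $C(\mu)<\infty$, $$\lim_{\epsilon\downarrow0}\tfrac1\epsilon\left[C(\mu+\epsilon(\mu'-\mu))-C(\mu)\right]=(\mu'-\mu)\cdot\nabla C(\mu),$$ where $0\cdot(\pm\infty)=0$ and the right-hand side is required to be well defined (no $\infty-\infty$). The environment is risk neutral if $u(t)=t$ for all $t$. Given $\mathcal E$ and a contract $t\in\mathbb R^M$, the agent's payoff from $\mu\in\Delta\Omega$ is $U(\mu)=\sum_m\big(\sum_n\mu_n\mathcal E_{n,m}\big)u(t_m)-C(\mu)$. For an outside option $\underline u\in\mathbb R$ and a budget $B>0$, $K^{\mathrm{LL}}_{\underline u}(\mathcal E;P)$ is the infimum of the expected payment $\mu_0\cdot\mathcal E t$ over the contracts $t\ge0$ such that $\mu_0$ maximizes $U$ over $\Delta\Omega$ and $\max_{\Delta\Omega}U\ge\underline u$; $K^{\mathrm{LL},B}_{\underline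 u}(\mathcal E;P)$ is the same infimum over contracts with $0\le t\le B$. Both are $+\infty$ if no contract is feasible. Write $K^{\mathrm{LL}}=K^{\mathrm{LL}}_0$ and $K^{\mathrm{LL},B}=K^{\mathrm{LL},B}_0$ (outside option normalized to $0$). **Theorem.** Let $\mathcal E\in\mathbb R^{N\times M}$ and $\mathcal E'\in\mathbb R^{N\times M'}$ be experiments and let $B>0$. The following are equivalent: 1. $\operatorname{Zon}\mathcal E\supseteq\operatorname{Zon}\mathcal E'$; 2. $\mathcal E'B_{M'}=\mathcal EH$ for some $H\in\mathbb R^{M\times2^{M'}}$ with all entries in $[0,1]$, where $B_{M'}$ is the $M'\times2^{M'}$ matrix whose columns are all the binary vectors in $\{0,1\}^{M'}$; 3. $\langle\mathcal E\mid\mu\rangle\ge_{\mathrm{lcx}}\langle\mathcal E'\mid\mu\rangle$ for every prior $\mu\in\Delta\Omega$; 4. $K^{\mathrm{LL},B}(\mathcal E;P)\le K^{\mathrm{LL},B}(\mathcal E';P)$ for every risk neutral environment $P$; 5. $K^{\mathrm{LL}}(\mathcal E;P)\le K^{\mathrm{LL}}(\mathcal E';P)$ for every environment $P$. Moreover, if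 these conditions hold, then the inequalities in (4) and (5) hold for every outside option: for all $\underline u\in\mathbb R$, $K^{\mathrm{LL},B}_{\underline u}(\mathcal E;P)\le K^{\mathrm{LL},B}_{\underline u}(\mathcal E';P)$ for every risk neutral $P$ and $K^{\mathrm{LL}}_{\underline u}(\mathcal E;P)\le K^{\mathrm{LL}}_{\underline u}(\mathcal E';P)$ for every $P$. -/

import Mathlib

open scoped ENNReal NNReal Topology Matrix

/-- An experiment about `N` states with `M` realizations: a row stochastic `N × M` matrix. -/
def IsExperiment {N M : ℕ} (E : Matrix (Fin N) (Fin M) ℝ) : Prop :=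
  (∀ n m, 0 ≤ E n m) ∧ ∀ n, ∑ m, E n m = 1

/-- The zonotope `{E v : 0 ≤ v ≤ 1}`. -/
def zonotope {N M : ℕ} (E : Matrix (Fin N) (Fin M) ℝ) : Set (Fin N → ℝ) :=
  {x | ∃ v : Fin M → ℝ, (∀ m, 0 ≤ v m ∧ v m ≤ 1) ∧ x = E *ᵥ v}

/-- The matrix whose columns are all binary vectors of length `k`, one column for each. -/
def binaryMatrix (k : ℕ) : Matrix (Fin k) (Fin k → Bool) ℝ :=
  Matrix.of fun i s => if s i then 1 else 0

/-- The probability of realization `m` when the state is distributed according to `μ`. -/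
def realizationProb {N M : ℕ} (E : Matrix (Fin N) (Fin M) ℝ) (μ : Fin N → ℝ) (m : Fin M) : ℝ :=
  ∑ n, μ n * E n m

/-- The posterior belief after realization `m`, by Bayes' rule. -/
noncomputable def posterior {N M : ℕ} (E : Matrix (Fin N) (Fin M) ℝ) (μ : Fin N → ℝ)
    (m : Fin M) : Fin N → ℝ :=
  fun n => μ n * E n m / realizationProb E μ m

/-- The distribution of the posterior belief. Realizations of probability zero get no weight. -/
noncomputable def posteriorDist {N M : ℕ} (E : Matrix (Fin N) (Fin M) ℝ) (μ : Fin N → ℝ) :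
    MeasureTheory.Measure (Fin N → ℝ) :=
  ∑ m, ENNReal.ofReal (realizationProb E μ m) • MeasureTheory.Measure.dirac (posterior E μ m)

/-- `F` dominates `G` in the linear convex order (for finitely supported distributions, so that
all the integrals exist). -/
def LinearConvexDominates {N : ℕ} (F G : MeasureTheory.Measure (Fin N → ℝ)) : Prop :=
  ∀ φ : ℝ → ℝ, ConvexOn ℝ Set.univ φ → ∀ β : Fin N → ℝ,
    ∫ x, φ (β ⬝ᵥ x) ∂G ≤ ∫ x, φ (β ⬝ᵥ x) ∂F

/-- Admissible utilities for money. -/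
structure IsMoneyUtility (u : ℝ → ℝ) : Prop where
  strictMono : StrictMono u
  continuous : Continuous u
  concave : ConcaveOn ℝ Set.univ u
  unbounded_above : ¬ BddAbove (Set.range u)
  unbounded_below : ¬ BddBelow (Set.range u)
  zero : u 0 = 0

/-- `g` is an extended-real Gateaux gradient of `C` at `μ`, relative to the simplex: along the
direction to every `μ'` in the simplex the one-sided derivative of `C` is `(μ' - μ) ⬝ g`. The
latter is computed with `0 * (±∞) = 0` and has to make sense, that is, no two of its summands are
`+∞` and `-∞`. -/
def HasGateauxGradientAt {N : ℕ} (C : (Fin N → ℝ) → ℝ≥0∞) (μ : Fin N → ℝ)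
    (g : Fin N → EReal) : Prop :=
  ∀ μ' ∈ stdSimplex ℝ (Fin N),
    (¬ ((∃ i, ((μ' i - μ i : ℝ) : EReal) * g i = ⊤) ∧
        ∃ j, ((μ' j - μ j : ℝ) : EReal) * g j = ⊥)) ∧
    Filter.Tendsto
      (fun ε : ℝ => ((C (μ + ε • (μ' - μ)) : EReal) - (C μ : EReal)) / (ε : EReal))
      (𝓝[>] 0) (𝓝 (∑ n, ((μ' n - μ n : ℝ) : EReal) * g n))

/-- Admissible production costs. Only the values of `C` on the simplex matter. The difference
quotients in the differentiability condition are meaningful where `C` is finite. -/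
structure IsProductionCost {N : ℕ} (C : (Fin N → ℝ) → ℝ≥0∞) : Prop where
  lsc : LowerSemicontinuousOn C (stdSimplex ℝ (Fin N))
  convex : ConvexOn ℝ≥0 (stdSimplex ℝ (Fin N)) C
  differentiable : ∃ grad : (Fin N → ℝ) → Fin N → EReal,
    ∀ μ ∈ stdSimplex ℝ (Fin N), C μ ≠ ⊤ → HasGateauxGradientAt C μ (grad μ)
  free_option : ∃ μ ∈ stdSimplex ℝ (Fin N), C μ = 0

/-- A moral hazard environment: a target state distribution, the agent's utility for money and
the agent's production cost. -/
structure Environment (N : ℕ) where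
  target : Fin N → ℝ
  utility : ℝ → ℝ
  cost : (Fin N → ℝ) → ℝ≥0∞
  target_mem : target ∈ stdSimplex ℝ (Fin N)
  isMoneyUtility : IsMoneyUtility utility
  isProductionCost : IsProductionCost cost

/-- The environment has a risk neutral agent. -/
def Environment.RiskNeutral {N : ℕ} (P : Environment N) : Prop :=
  ∀ x, P.utility x = x

/-- The agent's expected payoff from producing `μ` under the contract `t`. -/
noncomputable def agentPayoff {N M : ℕ} (E : Matrix (Fin N) (Fin M) ℝ) (P : Environment N)
    (t : Fin M → ℝ) (μ : Fin N → ℝ) : EReal :=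
  ((∑ m, realizationProb E μ m * P.utility (t m) : ℝ) : EReal) - (P.cost μ : EReal)

/-- Incentive constraint: the target is an optimal choice of the agent. -/
def IncentiveConstraint {N M : ℕ} (E : Matrix (Fin N) (Fin M) ℝ) (P : Environment N)
    (t : Fin M → ℝ) : Prop :=
  IsMaxOn (agentPayoff E P t) (stdSimplex ℝ (Fin N)) P.target

/-- Participation constraint with outside option `w`. -/
def ParticipationConstraint {N M : ℕ} (w : ℝ) (E : Matrix (Fin N) (Fin M) ℝ) (P : Environment N)
    (t : Fin M → ℝ) : Prop :=
  (w : EReal) ≤ ⨆ μ ∈ stdSimplex ℝ (Fin N), agentPayoff E P t μ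

/-- The principal's minimal expected payment, over the contracts in `T` that satisfy the incentive
and the participation constraint. It is `+∞` if there is no such contract. -/
noncomputable def indirectCost {N M : ℕ} (w : ℝ) (E : Matrix (Fin N) (Fin M) ℝ)
    (P : Environment N) (T : Set (Fin M → ℝ)) : EReal :=
  sInf {c : EReal | ∃ t ∈ T, IncentiveConstraint E P t ∧ ParticipationConstraint w E P t ∧
    c = ((∑ m, realizationProb E P.target m * t m : ℝ) : EReal)}

/-- Indirect cost under limited liability. -/
noncomputable def costLL {N M : ℕ} (w : ℝ) (E : Matrix (Fin N) (Fin M) ℝ)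
    (P : Environment N) : EReal :=
  indirectCost w E P {t | ∀ m, 0 ≤ t m}

/-- Indirect cost under limited liability and the ex post budget `B`. -/
noncomputable def costLLB {N M : ℕ} (w B : ℝ) (E : Matrix (Fin N) (Fin M) ℝ)
    (P : Environment N) : EReal :=
  indirectCost w E P {t | ∀ m, 0 ≤ t m ∧ t m ≤ B}

/-!
Inclusion of zonotopes is inclusion of compact convex sets, hence an inequality between support
functions, and the support function of the zonotope of `E` in direction `β` is the sum of the
positive parts of the coordinates of `β ᵥ* E` (`zonotopeSupport`, `zonotope_subset_iff`). It is
attained at binary vectors, which gives the matrix criterion.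

For linear convex dominance, the expectation of a hinge `max (x - k) 0` under the distribution of
posteriors is a value of the support function. On a finite set of reals every convex function is an
affine function plus a nonnegative combination of hinges (`exists_eq_sum_hinge`), and affine
functions have the same expectation under all experiments.

If the zonotopes are nested, the utility payments of a contract under `E'` are cut into layers, each
a multiple of a binary vector; each layer can be replicated under `E` by a vector in the unit cube.
The agent's payoff is unchanged for every production choice, and since the inverse of a concave
utility is convex the replicated contract is at most as expensive (`exists_replication`). It also
respects every upper bound on payments, so that budgets are kept.

Conversely, suppose that a direction `β` separates a point `g = E' b`, with `b` binary, from the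
zonotope of `E`. By central symmetry one may assume `∑ n, β n ≤ 0`. A quadratic cost function has
gradient `g` (times `B`, if there is a budget `B`) at the uniform target, up to a constant;
incentive compatibility then says that the expected utilities in the states are this gradient plus
some constant `c` (`exists_environment`). Under `E'` the value `c = 0` is feasible. Under `E` a budget
forces `c` to be positive and bounded away from zero. Without a budget, a utility with a sharp kink
at `1` plays its role: either `c` is bounded away from zero, or a substantial amount of utility is
paid above the kink, where it is expensive.
-/

/-! ### The support function of a zonotope -/

/-- The support function of the zonotope of `E` in direction `β`; it sums the positive parts of the
coordinates of `β` times `E`. -/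
noncomputable def zonotopeSupport {N M : ℕ} (E : Matrix (Fin N) (Fin M) ℝ) (β : Fin N → ℝ) : ℝ :=
  ∑ m, max ((β ᵥ* E) m) 0

lemma dotProduct_mulVec_le_zonotopeSupport {N M : ℕ} (E : Matrix (Fin N) (Fin M) ℝ)
    (β : Fin N → ℝ) {v : Fin M → ℝ} (hv : ∀ m, 0 ≤ v m ∧ v m ≤ 1) :
    β ⬝ᵥ (E *ᵥ v) ≤ zonotopeSupport E β := by
  rw [Matrix.dotProduct_mulVec]
  refine Finset.sum_le_sum fun m _ => ?_
  rcases le_total ((β ᵥ* E) m) 0 with h | h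
  · exact (mul_nonpos_of_nonpos_of_nonneg h (hv m).1).trans (le_max_right _ _)
  · exact (mul_le_of_le_one_right h (hv m).2).trans (le_max_left _ _)

/-- The support function is attained at a binary vector. -/
lemma exists_binary_dotProduct_eq_zonotopeSupport {N M : ℕ} (E : Matrix (Fin N) (Fin M) ℝ)
    (β : Fin N → ℝ) :
    ∃ s : Fin M → Bool, β ⬝ᵥ (E *ᵥ fun m => if s m then 1 else 0) = zonotopeSupport E β := by
  classical
  refine ⟨fun m => decide (0 < (β ᵥ* E) m), ?_⟩
  rw [Matrix.dotProduct_mulVec]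
  refine Finset.sum_congr rfl fun m _ => ?_
  by_cases h : 0 < (β ᵥ* E) m
  · simp [h, h.le]
  · simp [h, not_lt.1 h]

lemma zonotope_eq_image {N M : ℕ} (E : Matrix (Fin N) (Fin M) ℝ) :
    zonotope E = E.mulVecLin '' Set.Icc 0 1 := by
  ext x
  simp only [zonotope, Set.mem_ofPred_eq, Set.mem_image, Set.mem_Icc, Pi.le_def,
    Matrix.mulVecLin_apply, Pi.zero_apply, Pi.one_apply]
  exact ⟨fun ⟨v, h, e⟩ => ⟨v, ⟨fun m => (h m).1, fun m => (h m).2⟩, e.symm⟩,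
    fun ⟨v, h, e⟩ => ⟨v, fun m => ⟨h.1 m, h.2 m⟩, e.symm⟩⟩

lemma convex_zonotope {N M : ℕ} (E : Matrix (Fin N) (Fin M) ℝ) : Convex ℝ (zonotope E) := by
  rw [zonotope_eq_image]
  exact (convex_Icc 0 1).linear_image _

lemma isClosed_zonotope {N M : ℕ} (E : Matrix (Fin N) (Fin M) ℝ) : IsClosed (zonotope E) := by
  rw [zonotope_eq_image]
  exact (isCompact_Icc.image (LinearMap.continuous_of_finiteDimensional _)).isClosed

lemma mulVec_binary_mem_zonotope {N M : ℕ} (E : Matrix (Fin N) (Fin M) ℝ) (s : Fin M → Bool) :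
    (E *ᵥ fun m => if s m then 1 else 0) ∈ zonotope E :=
  ⟨_, fun m => by cases s m <;> simp, rfl⟩

/-- A point belongs to the zonotope if no direction separates it from the zonotope. -/
lemma mem_zonotope_of_forall_le {N M : ℕ} {E : Matrix (Fin N) (Fin M) ℝ} {x : Fin N → ℝ}
    (h : ∀ β : Fin N → ℝ, β ⬝ᵥ x ≤ zonotopeSupport E β) : x ∈ zonotope E := by
  by_contra hx
  obtain ⟨f, c, hf, hc⟩ := geometric_hahn_banach_closed_point (convex_zonotope E)
    (isClosed_zonotope E) hx
  set β : Fin N → ℝ := fun i => f (Pi.single i 1) with hβ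
  have hfβ : ∀ y, f y = β ⬝ᵥ y := by
    intro y
    conv_lhs => rw [pi_eq_sum_univ' y]
    simp only [map_sum, map_smul, smul_eq_mul, dotProduct, hβ]
    exact Finset.sum_congr rfl fun i _ => mul_comm _ _
  obtain ⟨s, hs⟩ := exists_binary_dotProduct_eq_zonotopeSupport E β
  have h1 := hf _ (mulVec_binary_mem_zonotope E s)
  rw [hfβ, hs] at h1
  rw [hfβ] at hc
  linarith [h β]

lemma zonotope_subset_iff {N M M' : ℕ} {E : Matrix (Fin N) (Fin M) ℝ}
    {E' : Matrix (Fin N) (Fin M') ℝ} :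
    zonotope E' ⊆ zonotope E ↔ ∀ β, zonotopeSupport E' β ≤ zonotopeSupport E β := by
  constructor
  · intro h β
    obtain ⟨s, hs⟩ := exists_binary_dotProduct_eq_zonotopeSupport E' β
    obtain ⟨v, hv, e⟩ := h (mulVec_binary_mem_zonotope E' s)
    rw [← hs, e]
    exact dotProduct_mulVec_le_zonotopeSupport E β hv
  · rintro h x ⟨v, hv, rfl⟩
    exact mem_zonotope_of_forall_le fun β =>
      (dotProduct_mulVec_le_zonotopeSupport E' β hv).trans (h β)

lemma zonotope_subset_iff_exists_matrix {N M M' : ℕ} {E : Matrix (Fin N) (Fin M) ℝ}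
    {E' : Matrix (Fin N) (Fin M') ℝ} :
    zonotope E' ⊆ zonotope E ↔ ∃ H : Matrix (Fin M) (Fin M' → Bool) ℝ,
      (∀ m s, 0 ≤ H m s ∧ H m s ≤ 1) ∧ E' * binaryMatrix M' = E * H := by
  constructor
  · intro h
    have key : ∀ s : Fin M' → Bool, ∃ v : Fin M → ℝ, (∀ m, 0 ≤ v m ∧ v m ≤ 1) ∧
        E' *ᵥ (fun m => if s m then 1 else 0) = E *ᵥ v :=
      fun s => h (mulVec_binary_mem_zonotope E' s)
    choose H hH hEH using key
    refine ⟨Matrix.of fun m s => H s m, fun m s => hH s m, ?_⟩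
    ext n s
    exact congrFun (hEH s) n
  · rintro ⟨H, hH, e⟩
    refine zonotope_subset_iff.2 fun β => ?_
    obtain ⟨s, hs⟩ := exists_binary_dotProduct_eq_zonotopeSupport E' β
    have : E' *ᵥ (fun m => if s m then 1 else 0) = E *ᵥ fun m => H m s := by
      ext n
      exact congrFun (congrFun e n) s
    rw [← hs, this]
    exact dotProduct_mulVec_le_zonotopeSupport E β fun m => hH m s

/-! ### Experiments as matrices -/

lemma sum_realizationProb_mul {N M : ℕ} (E : Matrix (Fin N) (Fin M) ℝ) (μ : Fin N → ℝ)
    (v : Fin M → ℝ) : ∑ m, realizationProb E μ m * v m = μ ⬝ᵥ (E *ᵥ v) := by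
  rw [Matrix.dotProduct_mulVec]; rfl

lemma IsExperiment.mulVec_const {N M : ℕ} {E : Matrix (Fin N) (Fin M) ℝ} (hE : IsExperiment E)
    (c : ℝ) : (E *ᵥ fun _ => c) = fun _ => c := by
  ext n
  simp only [Matrix.mulVec, dotProduct]
  rw [← Finset.sum_mul, hE.2, one_mul]

lemma IsExperiment.mulVec_nonneg {N M : ℕ} {E : Matrix (Fin N) (Fin M) ℝ} (hE : IsExperiment E)
    {v : Fin M → ℝ} (hv : ∀ m, 0 ≤ v m) (n : Fin N) : 0 ≤ (E *ᵥ v) n :=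
  Finset.sum_nonneg (s := Finset.univ) fun m _ => mul_nonneg (hE.1 n m) (hv m)

lemma IsExperiment.mulVec_le_one {N M : ℕ} {E : Matrix (Fin N) (Fin M) ℝ} (hE : IsExperiment E)
    {v : Fin M → ℝ} (hv : ∀ m, v m ≤ 1) (n : Fin N) : (E *ᵥ v) n ≤ 1 :=
  (Finset.sum_le_sum fun m _ => mul_le_of_le_one_right (hE.1 n m) (hv m)).trans_eq (hE.2 n)

lemma IsExperiment.realizationProb_nonneg {N M : ℕ} {E : Matrix (Fin N) (Fin M) ℝ}
    (hE : IsExperiment E) {μ : Fin N → ℝ} (hμ : μ ∈ stdSimplex ℝ (Fin N)) (m : Fin M) :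
    0 ≤ realizationProb E μ m :=
  Finset.sum_nonneg fun n _ => mul_nonneg (hμ.1 n) (hE.1 n m)

lemma IsExperiment.sum_vecMul {N M : ℕ} {E : Matrix (Fin N) (Fin M) ℝ}
    (hE : IsExperiment E) (β : Fin N → ℝ) : ∑ m, (β ᵥ* E) m = ∑ n, β n := by
  have := sum_realizationProb_mul E β fun _ => 1
  rw [hE.mulVec_const] at this
  simp only [mul_one, dotProduct] at this
  exact this

/-- The zonotope of an experiment is symmetric about one half of the all-ones vector. -/
lemma IsExperiment.zonotopeSupport_neg {N M : ℕ} {E : Matrix (Fin N) (Fin M) ℝ}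
    (hE : IsExperiment E) (β : Fin N → ℝ) :
    zonotopeSupport E (-β) = zonotopeSupport E β - ∑ n, β n := by
  rw [← hE.sum_vecMul, zonotopeSupport, zonotopeSupport, ← Finset.sum_sub_distrib]
  refine Finset.sum_congr rfl fun m _ => ?_
  rw [Matrix.neg_vecMul, Pi.neg_apply]
  rcases le_total ((β ᵥ* E) m) 0 with h | h
  · rw [max_eq_left (by linarith), max_eq_right h]; ring
  · rw [max_eq_right (by linarith), max_eq_left h]; ring

/-! ### Linear convex dominance -/

lemma integral_posteriorDist {N M : ℕ} {E : Matrix (Fin N) (Fin M) ℝ} (hE : IsExperiment E)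
    {μ : Fin N → ℝ} (hμ : μ ∈ stdSimplex ℝ (Fin N)) (φ : ℝ → ℝ) (β : Fin N → ℝ) :
    ∫ x, φ (β ⬝ᵥ x) ∂(posteriorDist E μ) =
      ∑ m, realizationProb E μ m * φ (((β * μ) ᵥ* E) m / realizationProb E μ m) := by
  rw [posteriorDist, MeasureTheory.integral_finsetSum_measure]
  · refine Finset.sum_congr rfl fun m _ => ?_
    rw [MeasureTheory.integral_smul_measure, MeasureTheory.integral_dirac,
      ENNReal.toReal_ofReal (hE.realizationProb_nonneg hμ m), smul_eq_mul]
    congr 2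
    simp only [dotProduct, posterior, Matrix.vecMul, Pi.mul_apply, Finset.sum_div]
    exact Finset.sum_congr rfl fun n _ => by ring
  · intro m _
    exact (MeasureTheory.integrable_dirac (by simp)).smul_measure ENNReal.ofReal_ne_top

/-- A state of positive prior probability cannot produce a realization of probability zero. Hence
the quotients in `integral_posteriorDist` never divide a nonzero number by zero. -/
lemma IsExperiment.vecMul_eq_zero {N M : ℕ} {E : Matrix (Fin N) (Fin M) ℝ} (hE : IsExperiment E)
    {μ : Fin N → ℝ} (hμ : μ ∈ stdSimplex ℝ (Fin N)) (β : Fin N → ℝ) {m : Fin M}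
    (h : realizationProb E μ m = 0) : ((β * μ) ᵥ* E) m = 0 := by
  have h0 : ∀ n, μ n * E n m = 0 := fun n =>
    (Finset.sum_eq_zero_iff_of_nonneg fun n _ => mul_nonneg (hμ.1 n) (hE.1 n m)).1 h n
      (Finset.mem_univ n)
  refine Finset.sum_eq_zero (s := (Finset.univ : Finset (Fin N))) fun n _ => ?_
  rw [Pi.mul_apply, mul_assoc, h0 n, mul_zero]

lemma realizationProb_mul_hinge {N M : ℕ} {E : Matrix (Fin N) (Fin M) ℝ} (hE : IsExperiment E)
    {μ : Fin N → ℝ} (hμ : μ ∈ stdSimplex ℝ (Fin N)) (β : Fin N → ℝ) (k : ℝ) (m : Fin M) :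
    realizationProb E μ m * max (((β * μ) ᵥ* E) m / realizationProb E μ m - k) 0 =
      max (((β * μ - k • μ) ᵥ* E) m) 0 := by
  have hp := hE.realizationProb_nonneg hμ m
  have hk : ((β * μ - k • μ) ᵥ* E) m = ((β * μ) ᵥ* E) m - k * realizationProb E μ m := by
    rw [Matrix.sub_vecMul, Matrix.smul_vecMul]; rfl
  rw [hk]
  rcases hp.eq_or_lt with h | h
  · rw [← h, hE.vecMul_eq_zero hμ β h.symm]; simp
  · rw [mul_max_of_nonneg _ _ hp, mul_zero, mul_sub, mul_div_cancel₀ _ h.ne', mul_comm k]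

/-- On a finite set of reals, a convex function is the sum of an affine function and finitely many
hinges `c * max (x - k) 0` with `c ≥ 0`. -/
lemma exists_eq_sum_hinge {φ : ℝ → ℝ} (hφ : ConvexOn ℝ Set.univ φ) (S : Finset ℝ) :
    ∃ (a b : ℝ) (K : Finset ℝ) (c : ℝ → ℝ), (∀ k ∈ K, 0 ≤ c k) ∧
      ∀ x ∈ S, φ x = a + b * x + ∑ k ∈ K, c k * max (x - k) 0 := by
  classical
  rcases S.eq_empty_or_nonempty with rfl | hS
  · exact ⟨0, 0, ∅, 0, by simp, by simp⟩
  have three : ∀ x y z : ℝ, x < y → y ≤ z →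
      φ y + (φ y - φ x) / (y - x) * (z - y) ≤ φ z := by
    intro x y z hxy hyz
    rcases hyz.eq_or_lt with rfl | hyz
    · simp
    have := hφ.slope_mono_adjacent (Set.mem_univ x) (Set.mem_univ z) hxy hyz
    rw [le_div_iff₀ (by linarith)] at this
    linarith
  -- The hinges sit strictly to the left of the last point, so that the representation is affine
  -- from there on; convexity keeps it below `φ` there, and makes the next hinge nonnegative.
  suffices H : ∀ T : Finset ℝ, T.Nonempty → ∃ (a b : ℝ) (K : Finset ℝ) (c : ℝ → ℝ) (s A D : ℝ),
      s ∈ T ∧ (∀ x ∈ T, x ≤ s) ∧ (∀ k ∈ K, 0 ≤ c k ∧ k < s) ∧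
      (∀ x ∈ T, φ x = a + b * x + ∑ k ∈ K, c k * max (x - k) 0) ∧
      (∀ x, s ≤ x → a + b * x + ∑ k ∈ K, c k * max (x - k) 0 = A + D * x) ∧
      (∀ x, s ≤ x → A + D * x ≤ φ x) by
    obtain ⟨a, b, K, c, _, _, _, _, _, h1, h2, _⟩ := H S hS
    exact ⟨a, b, K, c, fun k hk => (h1 k hk).1, h2⟩
  intro T
  induction T using Finset.induction_on_max with
  | empty => intro h; exact absurd h (by simp)
  | insert x T hx ih =>
    intro _
    rcases T.eq_empty_or_nonempty with rfl | hT
    · set d := φ x - φ (x - 1)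
      refine ⟨φ x - d * x, d, ∅, 0, x, φ x - d * x, d, by simp, by simp, by simp, by simp,
        by simp, fun y hy => ?_⟩
      have := three (x - 1) x y (by linarith) hy
      have e : (φ x - φ (x - 1)) / (x - (x - 1)) = d := by simp [d]
      rw [e] at this
      linarith
    · obtain ⟨a, b, K, c, s, A, D, hs, hmax, hK, hrep, haff, hle⟩ := ih hT
      have hsx : s < x := hx s hs
      have hsK : s ∉ K := fun h => lt_irrefl _ (hK s h).2
      set γ := (φ x - (A + D * x)) / (x - s) with hγ
      have hγx : γ * (x - s) = φ x - (A + D * x) := div_mul_cancel₀ _ (by linarith)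
      have hsum : ∀ y, ∑ k ∈ insert s K, Function.update c s γ k * max (y - k) 0 =
          γ * max (y - s) 0 + ∑ k ∈ K, c k * max (y - k) 0 := by
        intro y
        rw [Finset.sum_insert hsK, Function.update_self]
        congr 1
        refine Finset.sum_congr rfl fun k hk => ?_
        rw [Function.update_of_ne (by rintro rfl; exact hsK hk)]
      have haff' : ∀ y, s ≤ y → a + b * y + ∑ k ∈ insert s K,
          Function.update c s γ k * max (y - k) 0 = (A - γ * s) + (D + γ) * y := by
        intro y hy
        rw [hsum, max_eq_left (by linarith)]
        linarith [haff y hy]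
      have hφs : φ s = A + D * s := (hrep s hs).trans (haff s le_rfl)
      refine ⟨a, b, insert s K, Function.update c s γ, x, A - γ * s, D + γ, by simp, ?_, ?_, ?_,
        fun y hy => haff' y (hsx.le.trans hy), ?_⟩
      · intro y hy
        rcases Finset.mem_insert.1 hy with rfl | hy
        · exact le_rfl
        · exact (hx y hy).le
      · intro k hk
        rcases Finset.mem_insert.1 hk with rfl | hkK
        · rw [Function.update_self]
          exact ⟨div_nonneg (by linarith [hle x hsx.le]) (by linarith), hsx⟩
        · rw [Function.update_of_ne (by rintro rfl; exact hsK hkK)]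
          exact ⟨(hK k hkK).1, (hK k hkK).2.trans hsx⟩
      · intro y hy
        rcases Finset.mem_insert.1 hy with rfl | hy
        · rw [haff' _ hsx.le]; linarith
        · rw [hsum, max_eq_right (by linarith [hmax y hy]), hrep y hy]; ring
      · intro y hy
        have h3 := three s x y hsx hy
        have e : (φ x - φ s) / (x - s) = D + γ := by
          rw [div_eq_iff (by linarith), hφs]; linarith
        rw [e] at h3
        linarith

lemma linearConvexDominates_iff_zonotope_subset {N M M' : ℕ} {E : Matrix (Fin N) (Fin M) ℝ}
    {E' : Matrix (Fin N) (Fin M') ℝ} (hE : IsExperiment E) (hE' : IsExperiment E') :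
    zonotope E' ⊆ zonotope E ↔ ∀ μ ∈ stdSimplex ℝ (Fin N),
      LinearConvexDominates (posteriorDist E μ) (posteriorDist E' μ) := by
  classical
  rw [zonotope_subset_iff]
  constructor
  · intro h μ hμ φ hφ β
    set x : Fin M → ℝ := fun m => ((β * μ) ᵥ* E) m / realizationProb E μ m with hx
    set x' : Fin M' → ℝ := fun m => ((β * μ) ᵥ* E') m / realizationProb E' μ m with hx'
    obtain ⟨a, b, K, c, hc, hrep⟩ := exists_eq_sum_hinge hφ
      (Finset.univ.image x ∪ Finset.univ.image x')
    -- The affine part has the same expectation under every experiment, and the expectation of a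
    -- hinge is a value of the support function.
    have key : ∀ {L : ℕ} (F : Matrix (Fin N) (Fin L) ℝ), IsExperiment F →
        (∀ m, φ (((β * μ) ᵥ* F) m / realizationProb F μ m) =
          a + b * (((β * μ) ᵥ* F) m / realizationProb F μ m) + ∑ k ∈ K,
            c k * max (((β * μ) ᵥ* F) m / realizationProb F μ m - k) 0) →
        ∫ y, φ (β ⬝ᵥ y) ∂(posteriorDist F μ) =
          a + b * (∑ n, (β * μ) n) + ∑ k ∈ K, c k * zonotopeSupport F (β * μ - k • μ) := by
      intro L F hF hr
      have hid : ∀ m, realizationProb F μ m * (((β * μ) ᵥ* F) m / realizationProb F μ m) =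
          ((β * μ) ᵥ* F) m := by
        intro m
        rcases (hF.realizationProb_nonneg hμ m).eq_or_lt with h0 | h0
        · rw [hF.vecMul_eq_zero hμ β h0.symm]; simp
        · exact mul_div_cancel₀ _ h0.ne'
      rw [integral_posteriorDist hF hμ]
      have h1 : ∑ m, realizationProb F μ m = 1 := (hF.sum_vecMul μ).trans hμ.2
      have e : ∀ m, realizationProb F μ m * φ (((β * μ) ᵥ* F) m / realizationProb F μ m) =
          realizationProb F μ m * a + b * ((β * μ) ᵥ* F) m + ∑ k ∈ K,
            c k * max (((β * μ - k • μ) ᵥ* F) m) 0 := by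
        intro m
        rw [hr m, mul_add, mul_add, Finset.mul_sum]
        congr 1
        · rw [← mul_assoc, mul_comm _ b, mul_assoc, hid]
        · refine Finset.sum_congr rfl fun k _ => ?_
          rw [← realizationProb_mul_hinge hF hμ]; ring
      simp only [e, Finset.sum_add_distrib]
      rw [← Finset.sum_mul, h1, one_mul, ← Finset.mul_sum, hF.sum_vecMul, Finset.sum_comm]
      simp only [← Finset.mul_sum]
      rfl
    rw [key E hE fun m => hrep _ (by simp [hx]), key E' hE' fun m => hrep _ (by simp [hx'])]
    gcongr with k hk
    · exact hc k hk
    · exact h _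
  · intro h β
    rcases Nat.eq_zero_or_pos N with rfl | hN
    · simp [zonotopeSupport, Matrix.vecMul, dotProduct]
    have hN' : (N : ℝ) ≠ 0 := by positivity
    have hμ : (fun _ => (N : ℝ)⁻¹) ∈ stdSimplex ℝ (Fin N) :=
      ⟨fun _ => by positivity, by simp [hN']⟩
    have hconv : ConvexOn ℝ Set.univ fun x : ℝ => max (x - 0) 0 :=
      ((convexOn_id convex_univ).sub (concaveOn_const 0 convex_univ)).sup
        (convexOn_const 0 convex_univ)
    have := h _ hμ _ hconv ((N : ℝ) • β)
    rw [integral_posteriorDist hE hμ (fun x => max (x - 0) 0),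
      integral_posteriorDist hE' hμ (fun x => max (x - 0) 0)] at this
    simp only [realizationProb_mul_hinge hE hμ, realizationProb_mul_hinge hE' hμ] at this
    have e : ((N : ℝ) • β) * (fun _ => (N : ℝ)⁻¹) - (0 : ℝ) • (fun _ => (N : ℝ)⁻¹) = β := by
      ext n
      simp only [Pi.sub_apply, Pi.mul_apply, Pi.smul_apply, smul_eq_mul]
      field_simp
      ring
    rwa [e] at this

/-! ### Replicating a contract with a more informative experiment -/

/-- Raising the argument of a convex function by the fraction `h` of `δ` from a lower base `v` costs
at most the fraction `h` of raising it by `δ` from the base `s`. -/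
lemma ConvexOn.apply_add_mul_le {ψ : ℝ → ℝ} (hψ : ConvexOn ℝ Set.univ ψ) {v s h δ : ℝ}
    (hvs : v ≤ s) (hδ : 0 < δ) (h0 : 0 ≤ h) (h1 : h ≤ 1) :
    ψ (v + δ * h) ≤ ψ v + h * (ψ (s + δ) - ψ s) := by
  have e1 : ψ (v + δ * h) ≤ (1 - h) * ψ v + h * ψ (v + δ) := by
    have := hψ.2 (Set.mem_univ v) (Set.mem_univ (v + δ)) (sub_nonneg.2 h1) h0 (by ring)
    simp only [smul_eq_mul] at this
    rwa [show (1 - h) * v + h * (v + δ) = v + δ * h by ring] at this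
  have e2 : ψ (v + δ) - ψ v ≤ ψ (s + δ) - ψ s := by
    rcases hvs.eq_or_lt with rfl | hlt
    · exact le_rfl
    have a := hψ.secant_mono (Set.mem_univ v) (Set.mem_univ (v + δ)) (Set.mem_univ (s + δ))
      (by linarith) (by linarith) (by linarith)
    have b := hψ.secant_mono (Set.mem_univ (s + δ)) (Set.mem_univ v) (Set.mem_univ s)
      (by linarith) (by linarith) hvs
    rw [← neg_div_neg_eq, ← neg_div_neg_eq (ψ s - ψ (s + δ))] at b
    simp only [neg_sub, add_sub_cancel_left] at a b
    exact (div_le_div_iff_of_pos_right hδ).1 (a.trans b)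
  nlinarith

/-- Utility payments `v'` under `E'` are replicated under `E` layer by layer: each superlevel set of
`v'` is a binary vector, which inclusion of the zonotopes turns into a vector in the unit cube. By
convexity of `ψ` the new payments are not more expensive. The induction runs over the set `S` of
positive values that `v'` may take and removes the top layer. -/
lemma exists_replication {N M M' : ℕ} {E : Matrix (Fin N) (Fin M) ℝ}
    {E' : Matrix (Fin N) (Fin M') ℝ} (hE : IsExperiment E) (hE' : IsExperiment E')
    (hz : zonotope E' ⊆ zonotope E) {μ : Fin N → ℝ} (hμ : μ ∈ stdSimplex ℝ (Fin N))
    {ψ : ℝ → ℝ} (hψ : ConvexOn ℝ Set.univ ψ) (S : Finset ℝ) :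
    (∀ s ∈ S, 0 < s) → ∀ v' : Fin M' → ℝ, (∀ m, v' m ∈ insert 0 S) →
    ∃ v : Fin M → ℝ, (∀ m, 0 ≤ v m) ∧ (∀ c, 0 ≤ c → (∀ s ∈ S, s ≤ c) → ∀ m, v m ≤ c) ∧
      E *ᵥ v = E' *ᵥ v' ∧
      ∑ m, realizationProb E μ m * ψ (v m) ≤ ∑ m, realizationProb E' μ m * ψ (v' m) := by
  classical
  induction S using Finset.induction_on_max with
  | empty =>
    intro _ v' hv'
    have : v' = fun _ => 0 := funext fun m => by simpa using hv' m
    subst this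
    refine ⟨fun _ => 0, fun _ => le_rfl, fun c hc _ _ => hc, ?_, le_of_eq ?_⟩
    · rw [hE.mulVec_const, hE'.mulVec_const]
    · rw [sum_realizationProb_mul, sum_realizationProb_mul, hE.mulVec_const, hE'.mulVec_const]
  | insert x S hx ih =>
    intro hpos v' hv'
    have hx0 : 0 < x := hpos x (by simp)
    obtain ⟨s, hs, hsmax⟩ : ∃ s ∈ insert 0 S, ∀ y ∈ insert 0 S, y ≤ s :=
      ⟨_, Finset.max'_mem _ (Finset.insert_nonempty 0 S), fun y hy => Finset.le_max' _ y hy⟩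
    have hs0 : 0 ≤ s := hsmax 0 (by simp)
    have hsx : s < x := by
      rcases Finset.mem_insert.1 hs with rfl | h
      · exact hx0
      · exact hx s h
    obtain ⟨v, hv0, hvle, hEv, hcost⟩ := ih (fun y hy => hpos y (by simp [hy]))
      (fun m => if v' m = x then s else v' m) fun m => by
        have := hv' m
        split_ifs with h
        · exact hs
        · simp only [Finset.mem_insert] at this ⊢
          tauto
    have hvs : ∀ m, v m ≤ s := hvle s hs0 fun y hy => hsmax y (by simp [hy])
    obtain ⟨h, hh, hEh⟩ := hz (mulVec_binary_mem_zonotope E' fun m => decide (v' m = x))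
    simp only [decide_eq_true_eq] at hEh
    have hv'eq : v' = (fun m => if v' m = x then s else v' m) +
        (x - s) • fun m => if v' m = x then (1 : ℝ) else 0 := by
      ext m
      by_cases hm : v' m = x <;> simp [hm]
    refine ⟨v + (x - s) • h, fun m => ?_, fun c _ hcS m => ?_, ?_, ?_⟩
    · exact add_nonneg (hv0 m) (mul_nonneg (by linarith) (hh m).1)
    · have h1 := hcS x (by simp)
      have h2 : (x - s) * h m ≤ x - s := mul_le_of_le_one_right (by linarith) (hh m).2
      have h3 := hvs m
      simp only [Pi.add_apply, Pi.smul_apply, smul_eq_mul]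
      linarith
    · conv_rhs => rw [hv'eq]
      rw [Matrix.mulVec_add, Matrix.mulVec_add, Matrix.mulVec_smul, Matrix.mulVec_smul, hEv, hEh]
    · have hmass : ∑ m, realizationProb E μ m * h m =
          ∑ m, realizationProb E' μ m * if v' m = x then (1 : ℝ) else 0 := by
        rw [sum_realizationProb_mul, sum_realizationProb_mul, hEh]
      calc ∑ m, realizationProb E μ m * ψ ((v + (x - s) • h) m)
          ≤ ∑ m, realizationProb E μ m * (ψ (v m) + h m * (ψ x - ψ s)) := by
            refine Finset.sum_le_sum fun m _ =>
              mul_le_mul_of_nonneg_left ?_ (hE.realizationProb_nonneg hμ m)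
            have := hψ.apply_add_mul_le (hvs m) (sub_pos.2 hsx) (hh m).1 (hh m).2
            rwa [add_sub_cancel] at this
        _ = ∑ m, realizationProb E μ m * ψ (v m) +
              (∑ m, realizationProb E μ m * h m) * (ψ x - ψ s) := by
            simp only [mul_add, Finset.sum_add_distrib, Finset.sum_mul, mul_assoc]
        _ ≤ ∑ m, realizationProb E' μ m * ψ (if v' m = x then s else v' m) +
              (∑ m, realizationProb E' μ m * if v' m = x then (1 : ℝ) else 0) * (ψ x - ψ s) := by
            rw [hmass]; gcongr
        _ = ∑ m, realizationProb E' μ m * ψ (v' m) := by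
            rw [Finset.sum_mul, ← Finset.sum_add_distrib]
            refine Finset.sum_congr rfl fun m _ => ?_
            by_cases hm : v' m = x <;> simp [hm]; ring

/-- The form of `exists_replication` in which the positive values of `v'` are not listed. -/
lemma exists_replication_of_nonneg {N M M' : ℕ} {E : Matrix (Fin N) (Fin M) ℝ}
    {E' : Matrix (Fin N) (Fin M') ℝ} (hE : IsExperiment E) (hE' : IsExperiment E')
    (hz : zonotope E' ⊆ zonotope E) {μ : Fin N → ℝ} (hμ : μ ∈ stdSimplex ℝ (Fin N))
    {ψ : ℝ → ℝ} (hψ : ConvexOn ℝ Set.univ ψ) {v' : Fin M' → ℝ} (hv' : ∀ m, 0 ≤ v' m) :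
    ∃ v : Fin M → ℝ, (∀ m, 0 ≤ v m) ∧ (∀ c, 0 ≤ c → (∀ m, v' m ≤ c) → ∀ m, v m ≤ c) ∧
      E *ᵥ v = E' *ᵥ v' ∧
      ∑ m, realizationProb E μ m * ψ (v m) ≤ ∑ m, realizationProb E' μ m * ψ (v' m) := by
  classical
  obtain ⟨v, h0, hc, h⟩ := exists_replication hE hE' hz hμ hψ
    ((Finset.univ.image v').filter (0 < ·)) (fun s hs => (Finset.mem_filter.1 hs).2) v'
    fun m => by
      rcases (hv' m).eq_or_lt with h | h
      · simp [← h]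
      · simp [h]
  refine ⟨v, h0, fun c hc0 hle => hc c hc0 fun s hs => ?_, h⟩
  obtain ⟨m, -, rfl⟩ := Finset.mem_image.1 (Finset.mem_filter.1 hs).1
  exact hle m

lemma agentPayoff_congr {N M M' : ℕ} {E : Matrix (Fin N) (Fin M) ℝ}
    {E' : Matrix (Fin N) (Fin M') ℝ} {P : Environment N} {t : Fin M → ℝ} {t' : Fin M' → ℝ}
    (h : (E *ᵥ fun m => P.utility (t m)) = E' *ᵥ fun m => P.utility (t' m)) :
    agentPayoff E P t = agentPayoff E' P t' := by
  funext μ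
  rw [agentPayoff, agentPayoff, sum_realizationProb_mul E μ fun m => P.utility (t m),
    sum_realizationProb_mul E' μ fun m => P.utility (t' m), h]

/-- Contracts which give the agent the same utility in every state are equally feasible. -/
lemma indirectCost_le_indirectCost {N M M' : ℕ} {E : Matrix (Fin N) (Fin M) ℝ}
    {E' : Matrix (Fin N) (Fin M') ℝ} {P : Environment N} {T : Set (Fin M → ℝ)}
    {T' : Set (Fin M' → ℝ)} (w : ℝ)
    (h : ∀ t' ∈ T', ∃ t ∈ T,
      ((E *ᵥ fun m => P.utility (t m)) = E' *ᵥ fun m => P.utility (t' m)) ∧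
      ∑ m, realizationProb E P.target m * t m ≤ ∑ m, realizationProb E' P.target m * t' m) :
    indirectCost w E P T ≤ indirectCost w E' P T' := by
  refine le_sInf ?_
  rintro _ ⟨t', ht', hic, hpc, rfl⟩
  obtain ⟨t, ht, hu, hle⟩ := h t' ht'
  have hpay := agentPayoff_congr hu
  refine le_trans (sInf_le ?_) (EReal.coe_le_coe_iff.2 hle)
  refine ⟨t, ht, ?_, ?_, rfl⟩
  · rwa [IncentiveConstraint, hpay]
  · rwa [ParticipationConstraint, hpay]

lemma IsMoneyUtility.surjective {u : ℝ → ℝ} (hu : IsMoneyUtility u) : Function.Surjective u :=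
  hu.continuous.surjective
    (Filter.tendsto_atTop_atTop_of_monotone' hu.strictMono.monotone hu.unbounded_above)
    (Filter.tendsto_atBot_atBot_of_monotone' hu.strictMono.monotone hu.unbounded_below)

lemma costLL_le_of_zonotope_subset {N M M' : ℕ} {E : Matrix (Fin N) (Fin M) ℝ}
    {E' : Matrix (Fin N) (Fin M') ℝ} (hE : IsExperiment E) (hE' : IsExperiment E')
    (hz : zonotope E' ⊆ zonotope E) (w : ℝ) (P : Environment N) :
    costLL w E P ≤ costLL w E' P := by
  refine indirectCost_le_indirectCost w fun t' ht' => ?_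
  have hu := P.isMoneyUtility
  let f : ℝ ≃o ℝ := StrictMono.orderIsoOfSurjective P.utility hu.strictMono hu.surjective
  have hf : ∀ x, f x = P.utility x := fun _ => rfl
  have hψ : ConvexOn ℝ Set.univ f.symm := f.convexOn_symm hu.concave
  obtain ⟨v, hv0, -, hEv, hle⟩ := exists_replication_of_nonneg hE hE' hz P.target_mem hψ
    (v' := fun m => P.utility (t' m))
    fun m => by rw [← hu.zero]; exact hu.strictMono.monotone (ht' m)
  refine ⟨fun m => f.symm (v m), fun m => ?_, ?_, ?_⟩
  · rw [f.le_symm_apply, hf, hu.zero]; exact hv0 m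
  · simpa only [← hf, f.apply_symm_apply] using hEv
  · simpa only [← hf, f.symm_apply_apply] using hle

lemma costLLB_le_of_zonotope_subset {N M M' : ℕ} {E : Matrix (Fin N) (Fin M) ℝ}
    {E' : Matrix (Fin N) (Fin M') ℝ} (hE : IsExperiment E) (hE' : IsExperiment E')
    (hz : zonotope E' ⊆ zonotope E) (w : ℝ) {B : ℝ} (hB : 0 < B) {P : Environment N}
    (hP : P.RiskNeutral) : costLLB w B E P ≤ costLLB w B E' P := by
  refine indirectCost_le_indirectCost w fun t' ht' => ?_
  obtain ⟨v, hv0, hvB, hEv, hle⟩ := exists_replication_of_nonneg hE hE' hz P.target_mem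
    (convexOn_id convex_univ) fun m => (ht' m).1
  exact ⟨v, fun m => ⟨hv0 m, hvB B hB.le (fun m => (ht' m).2) m⟩, by
    simpa only [hP _] using hEv, hle⟩

/-! ### Environments with quadratic costs -/

/-- The multiple `κ` of the squared Euclidean distance from `a`, as a production cost. -/
noncomputable def quadraticCost {N : ℕ} (κ : ℝ) (a : Fin N → ℝ) (μ : Fin N → ℝ) : ℝ≥0∞ :=
  ENNReal.ofReal (κ * ∑ n, (μ n - a n) ^ 2)

lemma coe_quadraticCost {N : ℕ} {κ : ℝ} (hκ : 0 ≤ κ) (a μ : Fin N → ℝ) :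
    (quadraticCost κ a μ : EReal) = ((κ * ∑ n, (μ n - a n) ^ 2 : ℝ) : EReal) := by
  rw [quadraticCost, EReal.coe_ennreal_ofReal, max_eq_left]
  exact mul_nonneg hκ (Finset.sum_nonneg fun n _ => sq_nonneg _)

lemma EReal.coe_sum_finset {ι : Type*} (s : Finset ι) (f : ι → ℝ) :
    ((∑ i ∈ s, f i : ℝ) : EReal) = ∑ i ∈ s, (f i : EReal) :=
  map_sum (⟨⟨Real.toEReal, EReal.coe_zero⟩, EReal.coe_add⟩ : ℝ →+ EReal) f s

lemma hasGateauxGradientAt_quadraticCost {N : ℕ} {κ : ℝ} (hκ : 0 ≤ κ) (a μ : Fin N → ℝ) :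
    HasGateauxGradientAt (quadraticCost κ a) μ
      fun n => ((2 * κ * (μ n - a n) : ℝ) : EReal) := by
  intro μ' _
  constructor
  · rintro ⟨⟨i, hi⟩, -⟩
    rw [← EReal.coe_mul] at hi
    exact EReal.coe_ne_top _ hi
  set D : ℝ := ∑ n, (μ' n - μ n) * (2 * κ * (μ n - a n)) with hD
  set Q : ℝ := κ * ∑ n, (μ' n - μ n) ^ 2 with hQ
  have hsum : ∑ n, ((μ' n - μ n : ℝ) : EReal) * ((2 * κ * (μ n - a n) : ℝ) : EReal) =
      (D : EReal) := by
    rw [hD, EReal.coe_sum_finset]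
    exact Finset.sum_congr rfl fun n _ => (EReal.coe_mul _ _).symm
  rw [hsum]
  have hlim : Filter.Tendsto (fun ε : ℝ => ((D + ε * Q : ℝ) : EReal)) (𝓝[>] 0) (𝓝 (D : EReal)) := by
    refine (continuous_coe_real_ereal.tendsto D).comp ?_
    have : Filter.Tendsto (fun ε : ℝ => D + ε * Q) (𝓝 0) (𝓝 (D + 0 * Q)) :=
      Continuous.tendsto (by fun_prop) 0
    rw [zero_mul, add_zero] at this
    exact this.mono_left nhdsWithin_le_nhds
  refine hlim.congr' ?_
  filter_upwards [self_mem_nhdsWithin] with ε hε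
  have hε0 : ε ≠ 0 := ne_of_gt hε
  rw [coe_quadraticCost hκ, coe_quadraticCost hκ, ← EReal.coe_sub, ← EReal.coe_div]
  congr 1
  rw [eq_div_iff hε0, hD, hQ]
  simp only [Finset.mul_sum, Finset.sum_mul, add_mul, ← Finset.sum_sub_distrib,
    ← Finset.sum_add_distrib]
  refine Finset.sum_congr rfl fun n _ => ?_
  simp only [Pi.add_apply, Pi.smul_apply, Pi.sub_apply, smul_eq_mul]
  ring

lemma isProductionCost_quadraticCost {N : ℕ} {κ : ℝ} (hκ : 0 ≤ κ) {a : Fin N → ℝ}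
    (ha : a ∈ stdSimplex ℝ (Fin N)) : IsProductionCost (quadraticCost κ a) where
  lsc := by
    have : Continuous (quadraticCost κ a) :=
      ENNReal.continuous_ofReal.comp (by fun_prop)
    exact this.lowerSemicontinuous.lowerSemicontinuousOn _
  convex := by
    refine ⟨fun x hx y hy s t _ _ hst => ?_, fun x _ y _ s t _ _ hst => ?_⟩
    · exact convex_stdSimplex ℝ _ hx hy s.2 t.2 (by exact_mod_cast hst)
    · have hst' : (s : ℝ) + t = 1 := by exact_mod_cast hst
      have hx := Finset.sum_nonneg fun n (_ : n ∈ Finset.univ) => sq_nonneg (x n - a n)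
      have hy := Finset.sum_nonneg fun n (_ : n ∈ Finset.univ) => sq_nonneg (y n - a n)
      rw [quadraticCost, quadraticCost, quadraticCost, ENNReal.smul_def, ENNReal.smul_def,
        smul_eq_mul, smul_eq_mul, ← ENNReal.ofReal_coe_nnreal, ← ENNReal.ofReal_coe_nnreal,
        ← ENNReal.ofReal_mul s.coe_nonneg, ← ENNReal.ofReal_mul t.coe_nonneg,
        ← ENNReal.ofReal_add (by positivity) (by positivity)]
      refine ENNReal.ofReal_le_ofReal ?_
      rw [mul_left_comm, mul_left_comm (t : ℝ), ← mul_add]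
      refine mul_le_mul_of_nonneg_left ?_ hκ
      rw [Finset.mul_sum, Finset.mul_sum, ← Finset.sum_add_distrib]
      refine Finset.sum_le_sum fun n _ => ?_
      have e : (s • x + t • y) n - a n = s * (x n - a n) + t * (y n - a n) := by
        simp only [Pi.add_apply, Pi.smul_apply, NNReal.smul_def, smul_eq_mul]
        linear_combination (a n) * hst'
      rw [e]
      have := mul_nonneg (mul_nonneg s.2 t.2) (sq_nonneg (x n - y n))
      have ht : (t : ℝ) = 1 - s := by linarith
      simp only [NNReal.val_eq_coe, ht] at this ⊢
      nlinarith
  differentiable := ⟨_, fun μ _ _ => hasGateauxGradientAt_quadraticCost hκ a μ⟩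
  free_option := ⟨a, ha, by simp [quadraticCost]⟩

lemma nonpos_of_forall_mul_le_sq {δ Q r : ℝ} (hr : 0 < r) (hQ : 0 ≤ Q)
    (h : ∀ ε, 0 < ε → ε ≤ r → ε * δ ≤ ε ^ 2 * Q) : δ ≤ 0 := by
  by_contra! hδ
  set ε := min r (δ / (2 * (Q + 1))) with hε
  have hε0 : 0 < ε := lt_min hr (by positivity)
  have h1 := h ε hε0 (min_le_left _ _)
  have h2 : ε * (2 * (Q + 1)) ≤ δ := (le_div_iff₀ (by positivity)).1 (min_le_right _ _)
  have h3 : δ ≤ ε * Q := by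
    refine le_of_mul_le_mul_left ?_ hε0
    linarith [h1, sq ε, mul_assoc ε ε Q, congrArg (· * Q) (sq ε)]
  nlinarith

/-- For every vector `G` there is a quadratic production cost whose gradient at the uniform
distribution is `G` up to a constant. As the uniform distribution is interior, a contract then
implements it if and only if its expected utilities in the states are `G` up to a constant. -/
lemma exists_environment {N : ℕ} (hN : 0 < N) {u : ℝ → ℝ} (hu : IsMoneyUtility u)
    (G : Fin N → ℝ) :
    ∃ P : Environment N, P.utility = u ∧ P.target = (fun _ => (N : ℝ)⁻¹) ∧
      ∀ {M : ℕ} (E : Matrix (Fin N) (Fin M) ℝ) (t : Fin M → ℝ),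
        (IncentiveConstraint E P t ↔
          ∃ c : ℝ, ∀ n, (E *ᵥ fun m => u (t m)) n = G n + c) ∧
        (IsExperiment E → (∀ m, 0 ≤ t m) → ParticipationConstraint 0 E P t) := by
  classical
  have hN' : (0 : ℝ) < N := by exact_mod_cast hN
  set A : ℝ := ∑ n, |G n| + 1 with hA
  have hA0 : 0 < A := by positivity
  set avg : ℝ := (∑ n, G n) / N with havg
  have hGA : ∀ n, |G n| ≤ A := fun n =>
    (Finset.single_le_sum (fun n _ => abs_nonneg (G n)) (Finset.mem_univ n)).trans (by simp [hA])
  have havgA : |avg| ≤ A := by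
    have h1 : (1 : ℝ) ≤ N := by exact_mod_cast hN
    rw [havg, abs_div, abs_of_pos hN', div_le_iff₀ hN']
    have h2 := Finset.abs_sum_le_sum_abs G Finset.univ
    nlinarith
  -- This `κ` is large enough for the cost minimizer `a` to lie in the simplex.
  set κ : ℝ := N * A with hκ
  have hκ0 : 0 < κ := by positivity
  set μ₀ : Fin N → ℝ := fun _ => (N : ℝ)⁻¹ with hμ₀
  have hμ₀mem : μ₀ ∈ stdSimplex ℝ (Fin N) :=
    ⟨fun _ => by positivity, by simp [hμ₀, hN'.ne']⟩
  set a : Fin N → ℝ := fun n => (N : ℝ)⁻¹ - (G n - avg) / (2 * κ) with ha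
  have hamem : a ∈ stdSimplex ℝ (Fin N) := by
    refine ⟨fun n => ?_, ?_⟩
    · have h1 := (abs_le.1 (hGA n)).2
      have h2 := (abs_le.1 havgA).1
      rw [ha, sub_nonneg, div_le_iff₀ (by positivity), hκ]
      have : (N : ℝ)⁻¹ * (2 * (N * A)) = 2 * A := by field_simp
      linarith
    · rw [ha, Finset.sum_sub_distrib, ← Finset.sum_div, Finset.sum_sub_distrib]
      simp only [Finset.sum_const, Finset.card_univ, Fintype.card_fin, nsmul_eq_mul]
      rw [havg, mul_div_cancel₀ _ hN'.ne', mul_inv_cancel₀ hN'.ne']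
      simp
  refine ⟨⟨μ₀, u, quadraticCost κ a, hμ₀mem, hu, isProductionCost_quadraticCost hκ0.le hamem⟩,
    rfl, rfl, fun {M} E t => ?_⟩
  set y : Fin N → ℝ := E *ᵥ fun m => u (t m) with hy
  have hpay : ∀ μ, agentPayoff E ⟨μ₀, u, quadraticCost κ a, hμ₀mem, hu,
      isProductionCost_quadraticCost hκ0.le hamem⟩ t μ =
      ((μ ⬝ᵥ y - κ * ∑ n, (μ n - a n) ^ 2 : ℝ) : EReal) := by
    intro μ
    rw [agentPayoff, coe_quadraticCost hκ0.le, ← EReal.coe_sub,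
      sum_realizationProb_mul E μ fun m => u (t m)]
  have hdiff : ∀ μ ∈ stdSimplex ℝ (Fin N),
      (μ ⬝ᵥ y - κ * ∑ n, (μ n - a n) ^ 2) - (μ₀ ⬝ᵥ y - κ * ∑ n, (μ₀ n - a n) ^ 2) =
        ∑ n, (μ n - μ₀ n) * (y n - G n) - κ * ∑ n, (μ n - μ₀ n) ^ 2 := by
    intro μ hμ
    have h0 : ∑ n, (μ n - μ₀ n) * avg = 0 := by
      rw [← Finset.sum_mul, Finset.sum_sub_distrib, hμ.2, hμ₀mem.2]; simp
    rw [← add_zero (∑ n, (μ n - μ₀ n) * (y n - G n) - _), ← h0]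
    simp only [dotProduct, Finset.mul_sum, ← Finset.sum_sub_distrib, ← Finset.sum_add_distrib]
    refine Finset.sum_congr rfl fun n _ => ?_
    have e : G n = 2 * κ * (μ₀ n - a n) + avg := by
      simp only [ha, hμ₀]; field_simp; ring
    rw [e]; ring
  refine ⟨⟨fun h => ?_, ?_⟩, fun hE ht => ?_⟩
  · have hle : ∀ i j, y i - G i ≤ y j - G j := by
      intro i j
      set d : Fin N → ℝ := Pi.single i 1 - Pi.single j 1 with hd
      have hdz : ∑ n, d n * (y n - G n) = (y i - G i) - (y j - G j) := by
        simp [hd, sub_mul, Finset.sum_sub_distrib, Pi.single_apply]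
      have hdsum : ∑ n, d n = 0 := by simp [hd, Finset.sum_sub_distrib]
      have hd1 : ∀ n, -1 ≤ d n := by
        intro n
        simp only [hd, Pi.sub_apply, Pi.single_apply]
        split_ifs <;> norm_num
      have := nonpos_of_forall_mul_le_sq (δ := ∑ n, d n * (y n - G n))
        (Q := κ * ∑ n, d n ^ 2) (inv_pos.2 hN')
        (mul_nonneg hκ0.le (Finset.sum_nonneg fun n _ => sq_nonneg _)) fun ε hε hεN => by
          have hμ : μ₀ + ε • d ∈ stdSimplex ℝ (Fin N) := by
            refine ⟨fun n => ?_, ?_⟩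
            · have := mul_le_mul_of_nonneg_left (hd1 n) hε.le
              simp only [Pi.add_apply, Pi.smul_apply, smul_eq_mul, hμ₀]
              linarith
            · simp only [Pi.add_apply, Pi.smul_apply, smul_eq_mul, Finset.sum_add_distrib,
                ← Finset.mul_sum, hdsum, hμ₀mem.2, mul_zero, add_zero]
          have h1 := h hμ
          simp only [Set.mem_ofPred_eq] at h1
          rw [hpay, hpay, EReal.coe_le_coe_iff, ← sub_nonpos, hdiff _ hμ] at h1
          simp only [Pi.add_apply, Pi.smul_apply, smul_eq_mul, add_sub_cancel_left, mul_pow,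
            mul_assoc, ← Finset.mul_sum] at h1
          linarith
      linarith
    refine ⟨y ⟨0, hN⟩ - G ⟨0, hN⟩, fun n => ?_⟩
    linarith [hle n ⟨0, hN⟩, hle ⟨0, hN⟩ n]
  · rintro ⟨c, hc⟩ μ hμ
    simp only [Set.mem_ofPred_eq]
    rw [hpay, hpay, EReal.coe_le_coe_iff, ← sub_nonpos, hdiff μ hμ]
    have h0 : ∑ n, (μ n - μ₀ n) * (y n - G n) = 0 := by
      simp only [hc, add_sub_cancel_left]
      rw [← Finset.sum_mul, Finset.sum_sub_distrib, hμ.2, hμ₀mem.2]; simp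
    have := mul_nonneg hκ0.le
      (Finset.sum_nonneg fun n (_ : n ∈ Finset.univ) => sq_nonneg (μ n - μ₀ n))
    linarith
  · refine le_trans ?_ (le_iSup₂ (f := fun μ (_ : μ ∈ stdSimplex ℝ (Fin N)) =>
      agentPayoff E _ t μ) a hamem)
    rw [hpay, EReal.coe_le_coe_iff]
    have : 0 ≤ a ⬝ᵥ y := Finset.sum_nonneg fun n _ => mul_nonneg (hamem.1 n)
      (hE.mulVec_nonneg (fun m => by rw [← hu.zero]; exact hu.strictMono.monotone (ht m)) n)
    simpa using this

/-! ### Separating zonotopes by indirect costs -/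

/-- The central symmetry of the zonotopes allows the sign of `∑ n, β n` to be prescribed. -/
lemma exists_separating_direction {N M M' : ℕ} {E : Matrix (Fin N) (Fin M) ℝ}
    {E' : Matrix (Fin N) (Fin M') ℝ} (hE : IsExperiment E) (hE' : IsExperiment E')
    (h : ¬ zonotope E' ⊆ zonotope E) :
    ∃ (β : Fin N → ℝ) (s : Fin M' → Bool), ∑ n, β n ≤ 0 ∧
      zonotopeSupport E β < β ⬝ᵥ (E' *ᵥ fun m => if s m then 1 else 0) := by
  rw [zonotope_subset_iff] at h
  push Not at h
  obtain ⟨β, hβ⟩ := h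
  obtain ⟨γ, hγ, hlt⟩ : ∃ γ : Fin N → ℝ, ∑ n, γ n ≤ 0 ∧
      zonotopeSupport E γ < zonotopeSupport E' γ := by
    rcases le_total (∑ n, β n) 0 with h0 | h0
    · exact ⟨β, h0, hβ⟩
    · refine ⟨-β, by simpa using h0, ?_⟩
      rw [hE.zonotopeSupport_neg, hE'.zonotopeSupport_neg]
      linarith
  obtain ⟨s, hs⟩ := exists_binary_dotProduct_eq_zonotopeSupport E' γ
  exact ⟨γ, s, hγ, hs ▸ hlt⟩

lemma pos_of_zonotope_not_subset {N M M' : ℕ} {E : Matrix (Fin N) (Fin M) ℝ}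
    {E' : Matrix (Fin N) (Fin M') ℝ} (h : ¬ zonotope E' ⊆ zonotope E) : 0 < N := by
  rcases Nat.eq_zero_or_pos N with rfl | hN
  · refine absurd (zonotope_subset_iff.2 fun β => ?_) h
    simp [zonotopeSupport, Matrix.vecMul, dotProduct]
  · exact hN

/-- If `t'` is feasible under `E'` and all feasible contracts under `E` are more expensive by at
least `η > 0`, then the indirect cost under `E` is larger. -/
lemma indirectCost_lt_indirectCost {N M M' : ℕ} {E : Matrix (Fin N) (Fin M) ℝ}
    {E' : Matrix (Fin N) (Fin M') ℝ} {P : Environment N} {T : Set (Fin M → ℝ)}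
    {T' : Set (Fin M' → ℝ)} {w η : ℝ} (hη : 0 < η) {t' : Fin M' → ℝ} (ht' : t' ∈ T')
    (hic : IncentiveConstraint E' P t') (hpc : ParticipationConstraint w E' P t')
    (h : ∀ t ∈ T, IncentiveConstraint E P t →
      P.target ⬝ᵥ (E' *ᵥ t') + η ≤ P.target ⬝ᵥ (E *ᵥ t)) :
    indirectCost w E' P T' < indirectCost w E P T := by
  have h1 : indirectCost w E' P T' ≤ ((P.target ⬝ᵥ (E' *ᵥ t') : ℝ) : EReal) :=
    sInf_le ⟨t', ht', hic, hpc, by rw [sum_realizationProb_mul]⟩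
  have h2 : ((P.target ⬝ᵥ (E' *ᵥ t') + η : ℝ) : EReal) ≤ indirectCost w E P T := by
    refine le_sInf ?_
    rintro _ ⟨t, ht, hict, -, rfl⟩
    rw [sum_realizationProb_mul, EReal.coe_le_coe_iff]
    exact h t ht hict
  exact h1.trans_lt (lt_of_lt_of_le (EReal.coe_lt_coe_iff.2 (by linarith)) h2)

lemma isMoneyUtility_id : IsMoneyUtility fun x => x where
  strictMono := strictMono_id
  continuous := continuous_id
  concave := concaveOn_id convex_univ
  unbounded_above := by simp
  unbounded_below := by simp
  zero := rfl

/-- With costs whose gradient is `B` times a point `g` of `zonotope E'` outside of `zonotope E`, a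
contract under `E` within the budget `B` can only provide the right incentives if it pays some
amount `c` in addition, and `c` is bounded away from zero. -/
lemma zonotope_subset_of_costLLB_le {N M M' : ℕ} {E : Matrix (Fin N) (Fin M) ℝ}
    {E' : Matrix (Fin N) (Fin M') ℝ} (hE : IsExperiment E) (hE' : IsExperiment E') {B : ℝ}
    (hB : 0 < B)
    (h : ∀ P : Environment N, P.RiskNeutral → costLLB 0 B E P ≤ costLLB 0 B E' P) :
    zonotope E' ⊆ zonotope E := by
  by_contra hz
  have hN := pos_of_zonotope_not_subset hz
  have hN' : (N : ℝ) ≠ 0 := by positivity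
  obtain ⟨β, s, hβ, hlt⟩ := exists_separating_direction hE hE' hz
  set b : Fin M' → ℝ := fun m => if s m then 1 else 0 with hb
  have hb01 : ∀ m, 0 ≤ b m ∧ b m ≤ 1 := fun m => by cases hs : s m <;> simp [hb, hs]
  set g := E' *ᵥ b with hg
  obtain ⟨P, hPu, hPt, hP⟩ := exists_environment hN isMoneyUtility_id (B • g)
  refine absurd (h P fun x => by rw [hPu]) (not_le.2 ?_)
  set δ := β ⬝ᵥ g - zonotopeSupport E β with hδ
  have hδ0 : 0 < δ := sub_pos.2 hlt
  set σ := ∑ n, β n with hσ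
  have hσ1 : 0 < 1 - σ := by linarith
  -- The denominator is `1 - σ` rather than `-σ`, which may vanish.
  refine indirectCost_lt_indirectCost (η := B * δ / (1 - σ)) (by positivity) (t' := B • b)
    (fun m => ⟨mul_nonneg hB.le (hb01 m).1, mul_le_of_le_one_right hB.le (hb01 m).2⟩)
    ((hP E' _).1.2 ⟨0, fun n => ?_⟩)
    ((hP E' _).2 hE' fun m => mul_nonneg hB.le (hb01 m).1) fun t ht hic => ?_
  · rw [add_zero]
    exact congrFun (Matrix.mulVec_smul E' B b) n
  · obtain ⟨c, hc⟩ := (hP E t).1.1 hic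
    have hEt : E *ᵥ t = B • g + fun _ => c := funext hc
    have h1 : β ⬝ᵥ (E *ᵥ t) ≤ B * zonotopeSupport E β := by
      have e : t = B • fun m => t m / B := by
        ext m
        simp [mul_div_cancel₀ _ hB.ne']
      have := dotProduct_mulVec_le_zonotopeSupport E β (v := fun m => t m / B)
        fun m => ⟨div_nonneg (ht m).1 hB.le, (div_le_one hB).2 (ht m).2⟩
      rw [e, Matrix.mulVec_smul, dotProduct_smul, smul_eq_mul]
      exact mul_le_mul_of_nonneg_left this hB.le
    have h2 : β ⬝ᵥ (E *ᵥ t) = B * (β ⬝ᵥ g) + σ * c := by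
      rw [hEt, dotProduct_add, dotProduct_smul, smul_eq_mul]
      simp only [dotProduct, ← Finset.sum_mul]
      rfl
    have h3 : P.target ⬝ᵥ (E *ᵥ t) = P.target ⬝ᵥ (E' *ᵥ (B • b)) + c := by
      rw [hEt, dotProduct_add, Matrix.mulVec_smul]
      congr 1
      simp [hPt, dotProduct, hN']
    rw [h3]
    have h4 : B * δ / (1 - σ) ≤ c := by
      rw [div_le_iff₀ hσ1]
      have h5 : B * δ ≤ -σ * c := by rw [hδ]; linarith
      have h6 : 0 ≤ c := by
        by_contra! hc0
        have := mul_nonneg_of_nonpos_of_nonpos hβ hc0.le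
        nlinarith [mul_pos hB hδ0]
      linarith
    linarith

/-- The utility with slope `1` up to `1` and slope `1 / K` above `1`. -/
lemma isMoneyUtility_kinked {K : ℝ} (hK : 1 ≤ K) :
    IsMoneyUtility fun t => min t (1 + (t - 1) / K) := by
  have hK0 : 0 < K := by linarith
  refine ⟨?_, by fun_prop, ?_, ?_, ?_, ?_⟩
  · intro x y hxy
    exact min_lt_min hxy (by gcongr)
  · refine (concaveOn_id convex_univ).inf ⟨convex_univ, fun x _ y _ a b _ _ hab => le_of_eq ?_⟩
    simp only [smul_eq_mul]
    field_simp
    linear_combination (K - 1) * hab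
  · rintro ⟨c, hc⟩
    have h1 : min (K * |c| + 1 + |c|) (1 + (K * |c| + 1 + |c| - 1) / K) ≤ c := hc ⟨_, rfl⟩
    have h2 : c < K * |c| + 1 + |c| := by nlinarith [le_abs_self c, abs_nonneg c]
    have h3 : c < 1 + (K * |c| + 1 + |c| - 1) / K := by
      have e : (K * |c| + 1 + |c| - 1) / K = |c| + |c| / K := by field_simp; ring
      rw [e]
      linarith [le_abs_self c, div_nonneg (abs_nonneg c) hK0.le]
    exact absurd h1 (not_le.2 (lt_min h2 h3))
  · rintro ⟨c, hc⟩
    have h1 : c ≤ min (c - 1) (1 + (c - 1 - 1) / K) := hc ⟨c - 1, rfl⟩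
    linarith [min_le_left (c - 1) (1 + (c - 1 - 1) / K)]
  · have : (1 : ℝ) / K ≤ 1 := (div_le_one hK0).2 hK
    refine min_eq_left ?_
    rw [zero_sub, neg_div]; linarith

lemma eq_add_mul_of_kinked {K : ℝ} (hK : 1 ≤ K) (t : ℝ) :
    t = min t (1 + (t - 1) / K) + (K - 1) * max (min t (1 + (t - 1) / K) - 1) 0 := by
  have hK0 : 0 < K := by linarith
  rcases le_total t 1 with ht | ht
  · have : t ≤ 1 + (t - 1) / K := by
      have : (1 - t) / K ≤ 1 - t := div_le_self (by linarith) hK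
      rw [← neg_sub 1 t, neg_div]; linarith
    rw [min_eq_left this, max_eq_right (by linarith)]; ring
  · have : 1 + (t - 1) / K ≤ t := by
      have : (t - 1) / K ≤ t - 1 := div_le_self (by linarith) hK
      linarith
    rw [min_eq_right this, max_eq_left (by simpa using div_nonneg (sub_nonneg.2 ht) hK0.le)]
    field_simp
    ring

/-- Without a budget, a sharp kink of the utility at `1` acts as one: beyond it the additional
incentives cost `K` per unit, so that avoiding the transfer `c` of the budgeted case does not pay
if `K` is large. -/
lemma zonotope_subset_of_costLL_le {N M M' : ℕ} {E : Matrix (Fin N) (Fin M) ℝ}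
    {E' : Matrix (Fin N) (Fin M') ℝ} (hE : IsExperiment E) (hE' : IsExperiment E')
    (h : ∀ P : Environment N, costLL 0 E P ≤ costLL 0 E' P) :
    zonotope E' ⊆ zonotope E := by
  by_contra hz
  have hN := pos_of_zonotope_not_subset hz
  have hN' : (0 : ℝ) < N := by positivity
  obtain ⟨β, s, hβ, hlt⟩ := exists_separating_direction hE hE' hz
  set b : Fin M' → ℝ := fun m => if s m then 1 else 0 with hb
  have hb01 : ∀ m, 0 ≤ b m ∧ b m ≤ 1 := fun m => by cases hs : s m <;> simp [hb, hs]
  set g := E' *ᵥ b with hg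
  set δ := β ⬝ᵥ g - zonotopeSupport E β with hδ
  have hδ0 : 0 < δ := sub_pos.2 hlt
  set σ := ∑ n, β n with hσ
  have hσ1 : 0 < 1 - σ := by linarith
  -- `L` bounds the value in direction `β` of a unit of expected utility paid above the kink.
  set L : ℝ := N * (∑ n, |β n| + 1) with hL
  have hL0 : 0 < L := by positivity
  -- With this `K`, a shortfall of `δ / 2` in direction `β` costs at least `2` above the kink, while
  -- a negative `c` saves at most `1`.
  set K : ℝ := 1 + 4 * L / δ with hK
  have hK1 : 1 ≤ K := by
    have : 0 ≤ 4 * L / δ := by positivity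
    linarith
  have hu := isMoneyUtility_kinked hK1
  set u : ℝ → ℝ := fun t => min t (1 + (t - 1) / K) with hu_def
  obtain ⟨P, hPu, hPt, hP⟩ := exists_environment hN hu g
  refine absurd (h P) (not_le.2 ?_)
  have hub : ∀ m, u (b m) = b m := by
    intro m
    have : (1 : ℝ) / K ≤ 1 := (div_le_one (by linarith)).2 hK1
    cases hs : s m
    · simpa [hb, hs] using hu.zero
    · simp [hb, hs, hu_def]
  refine indirectCost_lt_indirectCost (η := min (δ / (2 * (1 - σ))) 1)
    (lt_min (by positivity) one_pos) (t' := b) (fun m => (hb01 m).1)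
    ((hP E' _).1.2 ⟨0, fun n => by simp only [hub, add_zero]; rfl⟩)
    ((hP E' _).2 hE' fun m => (hb01 m).1) fun t ht hic => ?_
  obtain ⟨c, hc⟩ := (hP E t).1.1 hic
  set v : Fin M → ℝ := fun m => u (t m) with hv
  have hv0 : ∀ m, 0 ≤ v m := fun m => by
    rw [← hu.zero]; exact hu.strictMono.monotone (ht m)
  -- `r` is the part of the utility payments above the kink.
  set r : Fin M → ℝ := fun m => max (v m - 1) 0 with hr
  have hr0 : ∀ n, 0 ≤ (E *ᵥ r) n := hE.mulVec_nonneg fun m => le_max_right _ _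
  set X := P.target ⬝ᵥ (E *ᵥ r) with hX
  have hX' : X * N = ∑ n, (E *ᵥ r) n := by
    rw [hX, hPt]
    simp only [dotProduct, ← Finset.mul_sum]
    field_simp
  have hEv : E *ᵥ v = g + fun _ => c := funext hc
  have hpay : P.target ⬝ᵥ (E *ᵥ t) = P.target ⬝ᵥ g + c + (K - 1) * X := by
    have e : t = v + (K - 1) • r := funext fun m => eq_add_mul_of_kinked hK1 (t m)
    rw [e, Matrix.mulVec_add, Matrix.mulVec_smul, hEv, dotProduct_add, dotProduct_add,
      dotProduct_smul, smul_eq_mul]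
    congr 2
    simp [hPt, dotProduct, hN'.ne']
  have hXL : β ⬝ᵥ (E *ᵥ r) ≤ L * X := by
    have hβA : ∀ n, β n ≤ ∑ n, |β n| + 1 := fun n =>
      (le_abs_self _).trans ((Finset.single_le_sum (fun n _ => abs_nonneg (β n))
        (Finset.mem_univ n)).trans (by simp))
    calc β ⬝ᵥ (E *ᵥ r) ≤ ∑ n, (∑ n, |β n| + 1) * (E *ᵥ r) n :=
          Finset.sum_le_sum fun n _ => mul_le_mul_of_nonneg_right (hβA n) (hr0 n)
      _ = L * X := by rw [← Finset.mul_sum, ← hX', hL]; ring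
  have hcap : β ⬝ᵥ (E *ᵥ (v - r)) ≤ zonotopeSupport E β := by
    refine dotProduct_mulVec_le_zonotopeSupport E β fun m => ?_
    have := hv0 m
    simp only [Pi.sub_apply, hr]
    rcases le_total (v m - 1) 0 with h1 | h1
    · rw [max_eq_right h1]; constructor <;> linarith
    · rw [max_eq_left h1]; constructor <;> linarith
  have hβg : β ⬝ᵥ (E *ᵥ v) = β ⬝ᵥ g + σ * c := by
    rw [hEv, dotProduct_add]
    simp only [dotProduct, ← Finset.sum_mul]
    rfl
  have hmain : δ + σ * c ≤ L * X := by
    rw [Matrix.mulVec_sub, dotProduct_sub, hβg] at hcap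
    rw [hδ]; linarith
  have hc1 : -1 ≤ c := by
    have h1 := hE.mulVec_nonneg hv0 ⟨0, hN⟩
    rw [hEv, Pi.add_apply] at h1
    have h2 := hE'.mulVec_le_one (fun m => (hb01 m).2) ⟨0, hN⟩
    linarith
  have hKX : (K - 1) * X = 4 * (L * X) / δ := by rw [hK]; field_simp; ring
  rw [hpay, hKX, add_assoc]
  refine add_le_add_right ?_ _
  have hX0 : 0 ≤ L * X := by
    have : 0 ≤ X * N := hX' ▸ Finset.sum_nonneg fun n _ => hr0 n
    exact mul_nonneg hL0.le (nonneg_of_mul_nonneg_left this hN')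
  -- Either the transfer `c` itself is substantial, or a substantial amount is paid above the kink.
  rcases le_total (δ / (2 * (1 - σ))) c with hcase | hcase
  · have : 0 ≤ 4 * (L * X) / δ := by positivity
    exact (min_le_left _ _).trans (by linarith)
  · refine (min_le_right _ _).trans ?_
    have h1 : δ / 2 ≤ L * X := by
      refine le_trans ?_ hmain
      rw [le_div_iff₀ (by positivity)] at hcase
      rcases le_total c 0 with h0 | h0
      · nlinarith [mul_nonneg_of_nonpos_of_nonpos hβ h0]
      · nlinarith
    have h2 : 2 ≤ 4 * (L * X) / δ := by
      rw [le_div_iff₀ hδ0]; linarith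
    linarith

theorem theorem3 {N M M' : ℕ} (E : Matrix (Fin N) (Fin M) ℝ) (E' : Matrix (Fin N) (Fin M') ℝ)
    (hE : IsExperiment E) (hE' : IsExperiment E') (B : ℝ) (hB : 0 < B) :
    List.TFAE [
      zonotope E' ⊆ zonotope E,
      ∃ H : Matrix (Fin M) (Fin M' → Bool) ℝ,
        (∀ m s, 0 ≤ H m s ∧ H m s ≤ 1) ∧ E' * binaryMatrix M' = E * H,
      ∀ μ ∈ stdSimplex ℝ (Fin N),
        LinearConvexDominates (posteriorDist E μ) (posteriorDist E' μ),
      ∀ P : Environment N, P.RiskNeutral → costLLB 0 B E P ≤ costLLB 0 B E' P,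
      ∀ P : Environment N, costLL 0 E P ≤ costLL 0 E' P] ∧
    (zonotope E' ⊆ zonotope E → ∀ w : ℝ,
      (∀ P : Environment N, P.RiskNeutral → costLLB w B E P ≤ costLLB w B E' P) ∧
      ∀ P : Environment N, costLL w E P ≤ costLL w E' P) := by
  refine ⟨?_, fun hz w => ⟨fun P hP => costLLB_le_of_zonotope_subset hE hE' hz w hB hP,
    costLL_le_of_zonotope_subset hE hE' hz w⟩⟩
  tfae_have 1 ↔ 2 := zonotope_subset_iff_exists_matrix
  tfae_have 1 ↔ 3 := linearConvexDominates_iff_zonotope_subset hE hE'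
  tfae_have 1 → 4 := fun hz P hP => costLLB_le_of_zonotope_subset hE hE' hz 0 hB hP
  tfae_have 4 → 1 := zonotope_subset_of_costLLB_le hE hE' hB
  tfae_have 1 → 5 := fun hz => costLL_le_of_zonotope_subset hE hE' hz 0
  tfae_have 5 → 1 := zonotope_subset_of_costLL_le hE hE'
  tfae_finish
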